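/- **Setting.** Let $\mathcal M=(S,Act,Av,\Delta)$ be a Markov decision process with finite sets $S$ of states and $Act$ of actions, non-empty sets $Av(s)\subseteq Act$ of available actions, and a probability distribution $\Delta(s,a)$ over $S$ for every state-action pair $(s,a)$ (that is, $s\in S$, $a\in Av(s)$). A strategy maps every finite path to a distribution over the actions available in its last state; together with a state $s$ a strategy $\pi$ induces a probability measure $\mathbb P^\pi_s$ over infinite paths. Let $s_+\neq s_-$ and $\hat s$ be states and let $\varepsilon>0$. Put $$V(s)=\sup_\pi \mathbb P^\pi_s[\text{some visited state is } s_+],\qquad V(s,a)=\sum_{s'\in S}\Delta(s,a,s')\,V(s').$$ For a function $f$ on state-action pairs write $f(s)=\max_{a\in Av(s)}f(s,a)$. An end component is a pair $(R,B)$ of a non-empty set $R\subseteq S$ and a non-empty set $B$ of state-action pairs whose states lie in $R$, such that $\operatorname{supp}\Delta(s,a)\subseteq R$ for all $(s,a)\in B$, and any state of $R$ can be reached from any state of $R$ by a path with at least one step that stays in $R$ and uses only pairs of $B$. It is maximal if no other end component contains it in both components. **Algorithm.** Given initial bounds $Up_1,Lo_1$ and a (possibly randomized and history-dependent) procedure SamplePairs,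 start with $e=1$. While $Up_e(\hat s)-Lo_e(\hat s)\ge\varepsilon$: call SamplePairs with the current bounds $Up_e,Lo_e$ to obtain a set $\varrho_e$; set $$Up_{e+1}(s,a)=\sum_{s'}\Delta(s,a,s')\,Up_e(s'),\qquad Lo_{e+1}(s,a)=\sum_{s'}\Delta(s,a,s')\,Lo_e(s')$$ for $(s,a)\in\varrho_e$, and leave the bounds unchanged at all other pairs; increase $e$ by one. When the loop ends, return $(l,u)=(Lo_e(\hat s),Up_e(\hat s))$. All randomness is carried by a probability space $(\Omega,P)$; each $\omega\in\Omega$ determines one execution. **Assumptions.** 1. The maximal end components of $\mathcal M$ are exactly $(\{s_+\},\{s_+\}\times Av(s_+))$ and $(\{s_-\},\{s_-\}\times Av(s_-))$. 2. $Up_1$ and $Lo_1$ take values in $[0,1]$, $Lo_1(s,a)\le V(s,a)\le Up_1(s,a)$ for all state-action pairs, $Lo_1(s_+)=1$, and $Up_1(s_-)=0$. **Fairness.** An execution is fair if every call to SamplePairs that is made terminates and returns a non-empty set of state-action pairs, and, in case the loop is executed infinitely often, the following hold, where $S_\infty$ is the set of states that occur in infinitely many $\varrho_e$ and $\mathrm{MaxA}_\infty(s)$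 is the set of actions $a\in Av(s)$ that maximize $Up_e(s,\cdot)$ over $Av(s)$ for infinitely many $e$: (i) $\hat s\in S_\infty$; (ii) for all $s\in S_\infty$ and $a\in\mathrm{MaxA}_\infty(s)$, the pair $(s,a)$ lies in infinitely many $\varrho_e$; (iii) for all $s\in S_\infty$ and $a\in\mathrm{MaxA}_\infty(s)$, $\operatorname{supp}\Delta(s,a)\subseteq S_\infty$. **Theorem.** Under Assumptions 1 and 2: (a) every execution that terminates returns $(l,u)$ with $0\le u-l<\varepsilon$ and $V(\hat s)\in[l,u]$; (b) if every execution is fair, then every execution terminates and returns such a pair $(l,u)$; (c) if almost every execution is fair, then almost every execution terminates and returns such a pair $(l,u)$. -/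

import Mathlib

open MeasureTheory ProbabilityTheory Filter

/-- A Markov decision process with state set `S` and action set `Act` (both finite in all uses).
`trans s a` is only meaningful for `a ∈ av s`. Actions of different states need not be disjoint:
everything below is phrased with state-action pairs. -/
structure MDP (S Act : Type*) where
  /-- the available actions -/
  av : S → Finset Act
  av_nonempty : ∀ s, (av s).Nonempty
  /-- the transition function -/
  trans : S → Act → PMF S

namespace MDP

section Basic

variable {S Act : Type*} (M : MDP S Act)

/-- A (history-dependent, randomized) strategy. A finite path with `n` transitions is given by its
first `n` state-action pairs and its last state `s`; the choice is supported on the available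
actions of `s`. (Values on sequences that are not paths of the MDP have no influence.) -/
structure Strategy where
  choice : (n : ℕ) → (Fin n → S × Act) → S → PMF Act
  support_subset : ∀ n h s, (choice n h s).support ⊆ (M.av s : Set Act)

/-- One step inside `R` using an action of `B`. -/
def StepIn (R : Set S) (B : Set (S × Act)) (s s' : S) : Prop :=
  s ∈ R ∧ s' ∈ R ∧ ∃ a ∈ M.av s, (s, a) ∈ B ∧ s' ∈ (M.trans s a).support

/-- End components `(R, B)`; the set of actions `B` is given as a set of state-action pairs. -/
structure IsEndComponent (R : Set S) (B : Set (S × Act)) : Prop where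
  states_nonempty : R.Nonempty
  actions_nonempty : B.Nonempty
  available : ∀ q ∈ B, q.1 ∈ R ∧ q.2 ∈ M.av q.1
  closed : ∀ s ∈ R, ∀ a ∈ M.av s, (s, a) ∈ B → (M.trans s a).support ⊆ R
  connected : ∀ s ∈ R, ∀ s' ∈ R, Relation.TransGen (M.StepIn R B) s s'

/-- The set of maximal end components. -/
def mecs : Set (Set S × Set (S × Act)) :=
  {E | M.IsEndComponent E.1 E.2 ∧
    ∀ R' B', M.IsEndComponent R' B' → E.1 ⊆ R' → E.2 ⊆ B' → (R', B') = E}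

/-- The only maximal end components are `({sp}, av sp)` and `({sm}, av sm)`. -/
def MecFree (sp sm : S) : Prop :=
  M.mecs = {({sp}, {q | q.1 = sp ∧ q.2 ∈ M.av sp}), ({sm}, {q | q.1 = sm ∧ q.2 ∈ M.av sm})}

/-- The state bound `f(s) = max_{a ∈ av s} f(s, a)` of a function on state-action pairs. Values at
pairs `(s, a)` with `a ∉ av s` play no role. -/
noncomputable def stateBound (f : S → Act → ℝ) (s : S) : ℝ :=
  (M.av s).sup' (M.av_nonempty s) (f s)

/-- The weighted sum of `v` over the successors of `s` under `a`. -/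
noncomputable def expect [Fintype S] (v : S → ℝ) (s : S) (a : Act) : ℝ :=
  ∑ s', (M.trans s a s').toReal * v s'

end Basic

section Value

variable {S Act : Type*} [Fintype S] [Fintype Act]
  [MeasurableSpace S] [DiscreteMeasurableSpace S]
  [MeasurableSpace Act] [DiscreteMeasurableSpace Act]
  (M : MDP S Act)

/-- The law of the next state-action pair, given the state-action pairs number `0, …, n`. -/
noncomputable def nextKernel (π : M.Strategy) (n : ℕ) :
    Kernel ((_ : Finset.Iic n) → S × Act) (S × Act) :=
  Kernel.ofFunOfCountable fun h =>
    ((M.trans (h ⟨n, by simp⟩).1 (h ⟨n, by simp⟩).2).bind fun s' =>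
      (π.choice (n + 1)
        (fun i => h ⟨i, Finset.mem_Iic.2 (Nat.lt_succ_iff.1 i.isLt)⟩) s').map
          fun a => (s', a)).toMeasure

instance (π : M.Strategy) (n : ℕ) : IsMarkovKernel (M.nextKernel π n) :=
  ⟨fun _ => PMF.toMeasure.isProbabilityMeasure _⟩

/-- The probability measure over infinite sequences of state-action pairs that a strategy induces
from the state `s`. -/
noncomputable def pathMeasure (π : M.Strategy) (s : S) : Measure (ℕ → S × Act) :=
  Kernel.trajMeasure (X := fun _ => S × Act)
    (((π.choice 0 Fin.elim0 s).map fun a => (s, a)).toMeasure) (M.nextKernel π)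

/-- The sequences that eventually visit `T`. -/
def reach (T : Set S) : Set (ℕ → S × Act) := {ρ | ∃ i, (ρ i).1 ∈ T}

/-- The maximal reachability probability of `T` from `s`, over all strategies. -/
noncomputable def val (T : Set S) (s : S) : ℝ :=
  ⨆ π : M.Strategy, (M.pathMeasure π s).real (reach T)

/-- The value of a state-action pair. -/
noncomputable def pairVal (T : Set S) (s : S) (a : Act) : ℝ := M.expect (M.val T) s a

/-- The initial bounds take values in `[0, 1]`, are sound for the target set `{sp}`, and are tight
in `sp` (from below) and in `sm` (from above). -/
structure InputCorrect (sp sm : S) (Up Lo : S → Act → ℝ) : Prop where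
  up_mem : ∀ s, ∀ a ∈ M.av s, Up s a ∈ Set.Icc (0 : ℝ) 1
  lo_mem : ∀ s, ∀ a ∈ M.av s, Lo s a ∈ Set.Icc (0 : ℝ) 1
  lo_le : ∀ s, ∀ a ∈ M.av s, Lo s a ≤ M.pairVal {sp} s a
  le_up : ∀ s, ∀ a ∈ M.av s, M.pairVal {sp} s a ≤ Up s a
  lo_target : M.stateBound Lo sp = 1
  up_sink : M.stateBound Up sm = 0

/-- `(l, u)` is `ε`-optimal for the maximal probability of reaching `T` from `s`. -/
def EpsOptimal (T : Set S) (s : S) (ε l u : ℝ) : Prop :=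
  0 ≤ u - l ∧ u - l < ε ∧ M.val T s ∈ Set.Icc l u

end Value

section Algorithm

variable {S Act : Type*} (M : MDP S Act)

/-- The behaviour of the procedure `SamplePairs` in one fixed outcome of all randomness: the result
of the call in episode `e` (counted from `0`) with arguments `Up` and `Lo`, where `none` means that
the call does not terminate. -/
abbrev Sampler (S Act : Type*) : Type _ :=
  ℕ → (S → Act → ℝ) → (S → Act → ℝ) → Option (Finset (S × Act))

open Classical in
/-- Simultaneous Bellman update of the bounds `f` at all pairs in `K`. -/
noncomputable def update [Fintype S] (K : Finset (S × Act)) (f : S → Act → ℝ) : S → Act → ℝ :=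
  fun s a => if (s, a) ∈ K then M.expect (M.stateBound f) s a else f s a

/-- The configurations of the algorithm. -/
inductive Config (S Act : Type*) where
  /-- at the head of the while-loop with the current upper and lower bounds -/
  | loop (Up Lo : S → Act → ℝ)
  /-- inside a call to `SamplePairs` that never terminates -/
  | stuck
  /-- terminated with the result `(l, u)` -/
  | done (l u : ℝ)

open Classical in
/-- One evaluation of the loop condition, followed by one execution of the loop body or by the
return statement. -/
noncomputable def step [Fintype S] (s₀ : S) (ε : ℝ) (sample : Sampler S Act) (e : ℕ) :
    Config S Act → Config S Act
  | .loop Up Lo =>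
    if ε ≤ M.stateBound Up s₀ - M.stateBound Lo s₀ then
      match sample e Up Lo with
      | none => .stuck
      | some K => .loop (M.update K Up) (M.update K Lo)
    else .done (M.stateBound Lo s₀) (M.stateBound Up s₀)
  | .stuck => .stuck
  | .done l u => .done l u

/-- The configuration at the beginning of episode `e`. -/
noncomputable def config [Fintype S] (s₀ : S) (ε : ℝ) (Up₁ Lo₁ : S → Act → ℝ)
    (sample : Sampler S Act) : ℕ → Config S Act
  | 0 => .loop Up₁ Lo₁
  | e + 1 => M.step s₀ ε sample e (config s₀ ε Up₁ Lo₁ sample e)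

/-- The algorithm terminates and returns `(l, u)`. -/
def Returns [Fintype S] (s₀ : S) (ε : ℝ) (Up₁ Lo₁ : S → Act → ℝ) (sample : Sampler S Act)
    (l u : ℝ) : Prop :=
  ∃ e, M.config s₀ ε Up₁ Lo₁ sample e = .done l u

/-- The states that occur in infinitely many of the sets `K e`. -/
def statesInf (K : ℕ → Finset (S × Act)) : Set S :=
  {s | ∃ᶠ e in atTop, ∃ a, (s, a) ∈ K e}

/-- The state-action pairs that occur in infinitely many of the sets `K e`. -/
def pairsInf (K : ℕ → Finset (S × Act)) : Set (S × Act) :=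
  {q | ∃ᶠ e in atTop, q ∈ K e}

/-- The actions available in `s` that are optimal with respect to `f`. -/
def maxA (f : S → Act → ℝ) (s : S) : Set Act :=
  {a | a ∈ M.av s ∧ ∀ b ∈ M.av s, f s b ≤ f s a}

/-- The actions that are optimal in `s` for infinitely many of the bounds `Up e`. -/
def maxAInf (Up : ℕ → S → Act → ℝ) (s : S) : Set Act :=
  {a | ∃ᶠ e in atTop, a ∈ M.maxA (Up e) s}

/-- Fairness of an infinite sequence of upper bounds and sampled sets. -/
structure FairSeq (s₀ : S) (Up : ℕ → S → Act → ℝ) (K : ℕ → Finset (S × Act)) : Prop where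
  initial : s₀ ∈ statesInf K
  actions : ∀ s ∈ statesInf K, ∀ a ∈ M.maxAInf Up s, (s, a) ∈ pairsInf K
  successors : ∀ s ∈ statesInf K, ∀ a ∈ M.maxAInf Up s, (M.trans s a).support ⊆ statesInf K

/-- The fairness condition on `SamplePairs` along one execution of the algorithm: every call that is
made terminates and returns a non-empty set of state-action pairs, and if infinitely many episodes
are performed, then the sequences of bounds and of sampled sets are fair. -/
structure Fair [Fintype S] (s₀ : S) (ε : ℝ) (Up₁ Lo₁ : S → Act → ℝ)
    (sample : Sampler S Act) : Prop where
  call : ∀ e Up Lo, M.config s₀ ε Up₁ Lo₁ sample e = .loop Up Lo →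
    ε ≤ M.stateBound Up s₀ - M.stateBound Lo s₀ →
    ∃ K, sample e Up Lo = some K ∧ K.Nonempty ∧ ∀ q ∈ K, q.2 ∈ M.av q.1
  limit : ∀ (Up Lo : ℕ → S → Act → ℝ) (K : ℕ → Finset (S × Act)),
    (∀ e, M.config s₀ ε Up₁ Lo₁ sample e = .loop (Up e) (Lo e) ∧
      sample e (Up e) (Lo e) = some (K e)) →
    M.FairSeq s₀ Up K

end Algorithm

end MDP

/-!
The algorithm maintains sound bounds and stops once the gap at `s₀` is below `ε`, so two facts are
needed.

*Soundness.* The value satisfies the optimality equation `V(s) = max_a V(s, a)`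
(`MDP.val_of_notMem`; in `sp` it holds because `sp` is absorbing). It comes from the Markov property
at time one of the path measures (`MDP.pathMeasure_shift`), which is checked on initial segments of
sequences. By monotonicity of averages and maxima, Bellman updates then preserve
`Lo ≤ V ≤ Up` (`MDP.InputCorrect.update`, `MDP.config_invariant`).

*Termination.* The initial bounds need not be consistent with the Bellman operator, so the sequences
`Up e` and `Lo e` need not be monotone or converge. Let `U(s)` be the limit superior of the upper
bounds and `L(s)` the limit inferior of the lower bounds of a state `s`. In a fair infinite execution,
every state `s` updated infinitely often has an action `a`, optimal for the upper bounds infinitely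
often, such that `U(s)` is at most the average of `U` over the successors under `a`
(`MDP.exists_upperLimit_le_expect`); since `(s, a)` is updated infinitely often, `L(s)` is at least the
corresponding average of `L` (`MDP.expect_lowerLimit_le`). Hence `U - L` is at most its own average,
and all successors are again updated infinitely often. So the set where `U - L` is maximal can be
confined by choosing these actions, and contains an end component; the only maximal end components
being those of `sp` and `sm`, it contains `sp` or `sm`, where the gap is at most zero. Therefore
`U ≤ L` on all states updated infinitely often, in particular in `s₀`
(`MDP.FairSeq.upperLimit_le_lowerLimit`), which contradicts a gap that never drops below `ε`.
-/

namespace MDP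

/-! ### Measures on sequences and initial segments -/

/-- The sequences that agree with `ρ` up to and including index `n`. -/
def cyl {α : Type*} (n : ℕ) (ρ : ℕ → α) : Set (ℕ → α) := {x | ∀ i ≤ n, x i = ρ i}

theorem cyl_eq_preimage {α : Type*} (n : ℕ) (ρ : ℕ → α) :
    cyl n ρ = Preorder.frestrictLe (π := fun _ => α) n ⁻¹'
      {Preorder.frestrictLe (π := fun _ => α) n ρ} := by
  ext x
  simp [cyl, funext_iff, Preorder.frestrictLe, Finset.restrict]

theorem measurableSet_cyl {α : Type*} [MeasurableSpace α] [MeasurableSingletonClass α]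
    (n : ℕ) (ρ : ℕ → α) : MeasurableSet (cyl n ρ) := by
  rw [cyl_eq_preimage]
  exact (Preorder.measurable_frestrictLe (X := fun _ => α) n) (measurableSet_singleton _)

/-- A finite measure on sequences over a countable alphabet is determined by its values on
initial segments. -/
theorem measure_ext_cyl {α : Type*} [Countable α] [MeasurableSpace α]
    [MeasurableSingletonClass α] {μ ν : Measure (ℕ → α)} [IsFiniteMeasure μ] [IsFiniteMeasure ν]
    (h : ∀ n ρ, μ (cyl n ρ) = ν (cyl n ρ)) : μ = ν := by
  have hproj : IsProjectiveMeasureFamily (α := fun _ : ℕ => α)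
      (fun I : Finset ℕ => μ.map I.restrict) := by
    intro I J hJI
    rw [Measure.map_map (by fun_prop) (by fun_prop)]
    rfl
  have hμ : IsProjectiveLimit μ (fun I : Finset ℕ => μ.map I.restrict) := fun I => rfl
  refine hμ.unique ((isProjectiveLimit_nat_iff hproj ν).2 fun n => ?_)
  refine Measure.ext_of_singleton fun y => ?_
  obtain ⟨ρ, rfl⟩ : ∃ ρ : ℕ → α, Preorder.frestrictLe (π := fun _ => α) n ρ = y :=
    ⟨fun i => if hi : i ≤ n then y ⟨i, Finset.mem_Iic.2 hi⟩
      else y ⟨0, Finset.mem_Iic.2 (Nat.zero_le n)⟩, by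
      funext i
      simp [Preorder.frestrictLe, Finset.mem_Iic.1 i.2]⟩
  have hn := h n ρ
  rw [cyl_eq_preimage] at hn
  rw [Measure.map_apply (by fun_prop) (measurableSet_singleton _), ← hn]
  exact (Measure.map_apply (by fun_prop) (measurableSet_singleton _)).symm

/-! ### Path measures -/

section PathMeasure

variable {S Act : Type*} (M : MDP S Act)

/-- The probability that, under `π` and after the first `n + 1` state-action pairs of `ρ`, the next
pair is the one of `ρ`. -/
noncomputable def stepProb (π : M.Strategy) (ρ : ℕ → S × Act) (n : ℕ) : ENNReal :=
  M.trans (ρ n).1 (ρ n).2 (ρ (n + 1)).1 *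
    π.choice (n + 1) (fun i => ρ i) (ρ (n + 1)).1 (ρ (n + 1)).2

open Classical in
theorem map_pair_apply (s : S) (p : PMF Act) (q : S × Act) :
    (p.map fun a => (s, a)) q = if s = q.1 then p q.2 else 0 := by
  rw [PMF.map_apply]
  split_ifs with hs
  · subst hs
    rw [tsum_eq_single q.2]
    · simp
    · intro a ha
      rw [if_neg]
      rintro h
      exact ha (congrArg Prod.snd h).symm
  · rw [ENNReal.tsum_eq_zero]
    intro a
    rw [if_neg]
    rintro h
    exact hs (congrArg Prod.fst h).symm

theorem bind_map_pair_apply [Fintype S] (p : PMF S) (f : S → PMF Act) (q : S × Act) :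
    (p.bind fun s => (f s).map fun a => (s, a)) q = p q.1 * f q.1 q.2 := by
  classical
  rw [PMF.bind_apply, tsum_fintype]
  simp only [map_pair_apply, mul_ite, mul_zero]
  simp

variable [Fintype S] [Fintype Act]
  [MeasurableSpace S] [DiscreteMeasurableSpace S]
  [MeasurableSpace Act] [DiscreteMeasurableSpace Act]

instance (π : M.Strategy) (s : S) : IsProbabilityMeasure (M.pathMeasure π s) := by
  unfold pathMeasure
  infer_instance

theorem nextKernel_apply_singleton (π : M.Strategy) (ρ : ℕ → S × Act) (n : ℕ) :
    M.nextKernel π n (Preorder.frestrictLe (π := fun _ => S × Act) n ρ) {ρ (n + 1)} =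
      M.stepProb π ρ n := by
  change (PMF.toMeasure _) _ = _
  rw [PMF.toMeasure_apply_singleton _ _ (measurableSet_singleton _), bind_map_pair_apply]
  rfl

theorem pathMeasure_cyl_zero (π : M.Strategy) (s : S) (ρ : ℕ → S × Act) :
    M.pathMeasure π s (cyl 0 ρ) =
      ((π.choice 0 Fin.elim0 s).map fun a => (s, a)) (ρ 0) := by
  rw [cyl_eq_preimage, ← Measure.map_apply (by fun_prop) (measurableSet_singleton _)]
  unfold pathMeasure Kernel.trajMeasure
  rw [Measure.map_comp _ _ (by fun_prop), Kernel.traj_map_frestrictLe, Kernel.partialTraj_self,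
    Measure.id_comp, Measure.map_apply (by fun_prop) (measurableSet_singleton _)]
  rw [← PMF.toMeasure_apply_singleton _ _ (measurableSet_singleton _)]
  congr 1
  ext x
  simp only [Set.mem_preimage, Set.mem_singleton_iff]
  constructor
  · intro h
    exact congrFun h ⟨0, by simp⟩
  · rintro rfl
    funext i
    obtain ⟨i, hi⟩ := i
    obtain rfl : i = 0 := by simpa using hi
    rfl

/-- One more step multiplies the probability of an initial segment by `stepProb`; this is the
disintegration of `Kernel.trajMeasure` along its first coordinates. -/
theorem pathMeasure_cyl_succ (π : M.Strategy) (s : S) (ρ : ℕ → S × Act) (n : ℕ) :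
    M.pathMeasure π s (cyl (n + 1) ρ) = M.pathMeasure π s (cyl n ρ) * M.stepProb π ρ n := by
  have hmap := Kernel.map_frestrictLe_trajMeasure_compProd_eq_map_trajMeasure
    (X := fun _ => S × Act) (κ := M.nextKernel π) (a := n)
    (μ₀ := ((π.choice 0 Fin.elim0 s).map fun a => (s, a)).toMeasure)
  have happ := congrArg (fun μ => μ ({Preorder.frestrictLe (π := fun _ => S × Act) n ρ} ×ˢ
    {ρ (n + 1)})) hmap
  rw [Measure.compProd_apply_prod (measurableSet_singleton _) (measurableSet_singleton _),
    Measure.map_apply (by fun_prop)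
      ((measurableSet_singleton _).prod (measurableSet_singleton _)),
    lintegral_singleton, nextKernel_apply_singleton,
    Measure.map_apply (by fun_prop) (measurableSet_singleton _), ← cyl_eq_preimage] at happ
  rw [pathMeasure, mul_comm, happ]
  congr 1
  ext x
  simp only [cyl_eq_preimage, Set.mem_preimage, Set.mem_singleton_iff, Set.mem_prod]
  simp only [Preorder.frestrictLe, Finset.restrict, funext_iff, Subtype.forall,
    Finset.mem_Iic]
  constructor
  · intro h
    exact ⟨fun i hi => h i (by omega), h _ le_rfl⟩
  · rintro ⟨h, h'⟩ i hi
    rcases Nat.lt_or_ge n i with hlt | hge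
    · obtain rfl : i = n + 1 := by omega
      exact h'
    · exact h i hge

theorem pathMeasure_cyl (π : M.Strategy) (s : S) (ρ : ℕ → S × Act) (n : ℕ) :
    M.pathMeasure π s (cyl n ρ) =
      ((π.choice 0 Fin.elim0 s).map fun a => (s, a)) (ρ 0) *
        ∏ k ∈ Finset.range n, M.stepProb π ρ k := by
  induction n with
  | zero => simp [pathMeasure_cyl_zero]
  | succ n ih => rw [pathMeasure_cyl_succ, ih, Finset.prod_range_succ, mul_assoc]

end PathMeasure

/-! ### The first step of a path -/

section FirstStep

/-- The sequence `q, ρ 0, ρ 1, …`. -/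
def seqCons {α : Type*} (q : α) (ρ : ℕ → α) : ℕ → α
  | 0 => q
  | n + 1 => ρ n

variable {S Act : Type*} (M : MDP S Act)

/-- The continuation of the strategy `π` after the first state-action pair `q`. -/
def Strategy.tail {M : MDP S Act} (π : M.Strategy) (q : S × Act) : M.Strategy where
  choice n h s := π.choice (n + 1) (Fin.cons (α := fun _ => S × Act) q h) s
  support_subset n _ s := π.support_subset (n + 1) _ s

/-- The strategy that plays `d` in the first step and then follows `σ t`, where `t` is the state
reached by the first step. -/
noncomputable def Strategy.prepend {M : MDP S Act} (d : ∀ s, M.av s) (σ : S → M.Strategy) :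
    M.Strategy where
  choice
    | 0, _, s => PMF.pure (d s).1
    | 1, _, s => (σ s).choice 0 Fin.elim0 s
    | n + 2, h, s => (σ (h 1).1).choice (n + 1) (fun i => h i.succ) s
  support_subset
    | 0, _, s => by simp
    | 1, _, s => (σ s).support_subset _ _ _
    | n + 2, h, s => (σ (h 1).1).support_subset _ _ _

theorem stepProb_seqCons_succ (π : M.Strategy) (q : S × Act) (ρ : ℕ → S × Act) (n : ℕ) :
    M.stepProb π (seqCons q ρ) (n + 1) = M.stepProb (π.tail q) ρ n := by
  have : (fun i : Fin (n + 2) => seqCons q ρ i) =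
      Fin.cons (α := fun _ => S × Act) q (fun i : Fin (n + 1) => ρ i) := by
    funext i
    refine Fin.cases rfl (fun j => ?_) i
    simp [seqCons]
  unfold stepProb
  rw [this]
  rfl

theorem stepProb_seqCons_zero (π : M.Strategy) (q : S × Act) (ρ : ℕ → S × Act) :
    M.stepProb π (seqCons q ρ) 0 =
      M.trans q.1 q.2 (ρ 0).1 * (π.tail q).choice 0 Fin.elim0 (ρ 0).1 (ρ 0).2 := by
  have : (fun i : Fin 1 => seqCons q ρ i) =
      Fin.cons (α := fun _ => S × Act) q Fin.elim0 := by
    funext i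
    obtain rfl : i = 0 := Subsingleton.elim _ _
    rfl
  unfold stepProb
  rw [this]
  rfl

theorem measurableSet_reach [MeasurableSpace S] [DiscreteMeasurableSpace S]
    [MeasurableSpace Act] (T : Set S) : MeasurableSet (reach (Act := Act) T) := by
  have : reach (Act := Act) T = ⋃ i, (fun ρ : ℕ → S × Act => (ρ i).1) ⁻¹' T := by
    ext ρ
    simp [reach]
  rw [this]
  exact MeasurableSet.iUnion fun i => (by fun_prop : Measurable _) (MeasurableSet.of_discrete)

variable [Fintype S] [Fintype Act]
  [MeasurableSpace S] [DiscreteMeasurableSpace S]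
  [MeasurableSpace Act] [DiscreteMeasurableSpace Act]

/-- The two strategies may differ at histories that do not start in `s`, but from `s` these have
probability zero. -/
theorem pathMeasure_prepend_tail (d : ∀ s, M.av s) (σ : S → M.Strategy) (q : S × Act) (s : S) :
    M.pathMeasure ((Strategy.prepend d σ).tail q) s = M.pathMeasure (σ s) s := by
  classical
  refine measure_ext_cyl fun n ρ => ?_
  rw [pathMeasure_cyl, pathMeasure_cyl, map_pair_apply, map_pair_apply]
  split_ifs with h
  · subst h
    rfl
  · simp

/-- The Markov property at time one: after the first pair `(s, a)`, the rest of the path follows the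
continuation of the strategy from the successor state. -/
theorem pathMeasure_shift (π : M.Strategy) (s : S) {A : Set (ℕ → S × Act)}
    (hA : MeasurableSet A) :
    M.pathMeasure π s ((fun x n => x (n + 1)) ⁻¹' A) =
      ∑ a, π.choice 0 Fin.elim0 s a *
        ∑ t, M.trans s a t * M.pathMeasure (π.tail (s, a)) t A := by
  classical
  have hmeas : Measurable (fun (x : ℕ → S × Act) n => x (n + 1)) := by fun_prop
  let ν : Measure (ℕ → S × Act) := ∑ a, π.choice 0 Fin.elim0 s a •
    ∑ t, M.trans s a t • M.pathMeasure (π.tail (s, a)) t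
  have hν : ∀ B, ν B = ∑ a, π.choice 0 Fin.elim0 s a *
        ∑ t, M.trans s a t * M.pathMeasure (π.tail (s, a)) t B := by
    intro B
    simp [ν, Measure.finsetSum_apply]
  have hfin : IsFiniteMeasure ν := by
    refine ⟨?_⟩
    rw [hν]
    refine ENNReal.sum_lt_top.2 fun a _ => ENNReal.mul_lt_top (PMF.apply_lt_top _ _)
      (ENNReal.sum_lt_top.2 fun t _ => ENNReal.mul_lt_top (PMF.apply_lt_top _ _)
        (measure_lt_top _ _))
  have hfin' : IsFiniteMeasure ((M.pathMeasure π s).map fun x n => x (n + 1)) :=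
    Measure.isFiniteMeasure_map _ _
  have key : (M.pathMeasure π s).map (fun x n => x (n + 1)) = ν := by
    refine measure_ext_cyl fun n ρ => ?_
    rw [Measure.map_apply hmeas (measurableSet_cyl n ρ), hν]
    -- Split according to the first pair, which the shift forgets.
    have hunion : (fun (x : ℕ → S × Act) n => x (n + 1)) ⁻¹' cyl n ρ =
        ⋃ q ∈ (Finset.univ : Finset (S × Act)), cyl (n + 1) (seqCons q ρ) := by
      ext x
      simp only [cyl, Set.mem_preimage, Set.mem_ofPred_eq, Set.mem_iUnion, Finset.mem_univ,
        exists_prop, true_and]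
      constructor
      · intro h
        refine ⟨x 0, fun i hi => ?_⟩
        cases i with
        | zero => rfl
        | succ i => exact h i (by omega)
      · rintro ⟨q, h⟩ i hi
        exact h (i + 1) (by omega)
    rw [hunion, measure_biUnion_finset]
    · rw [Fintype.sum_prod_type]
      rw [Finset.sum_eq_single s]
      · refine Finset.sum_congr rfl fun a _ => ?_
        rw [pathMeasure_cyl, map_pair_apply, Finset.prod_range_succ', stepProb_seqCons_zero]
        simp only [stepProb_seqCons_succ, pathMeasure_cyl, map_pair_apply]
        rw [if_pos (by rfl), Finset.sum_eq_single (ρ 0).1]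
        · simp only [seqCons, if_true]
          ring
        · intro t _ ht
          simp [ht]
        · simp
      · intro t _ ht
        refine Finset.sum_eq_zero fun a _ => ?_
        rw [pathMeasure_cyl, map_pair_apply, if_neg (fun h => ht h.symm), zero_mul]
      · simp
    · intro q _ q' _ hqq
      refine Set.disjoint_left.2 fun x hx hx' => hqq ?_
      exact (hx 0 (Nat.zero_le _)).symm.trans (hx' 0 (Nat.zero_le _))
    · exact fun q _ => measurableSet_cyl _ _
  rw [← hν, ← key, Measure.map_apply hmeas hA]

theorem ae_fst_zero (π : M.Strategy) (s : S) : ∀ᵐ ρ ∂M.pathMeasure π s, (ρ 0).1 = s := by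
  classical
  rw [ae_iff]
  have hunion : {ρ : ℕ → S × Act | ¬ (ρ 0).1 = s} ⊆
      ⋃ q ∈ {q : S × Act | q.1 ≠ s}, cyl 0 (fun _ => q) := by
    intro ρ hρ
    simp only [Set.mem_iUnion]
    refine ⟨ρ 0, hρ, fun i hi => ?_⟩
    rw [Nat.le_zero.1 hi]
  refine measure_mono_null hunion ?_
  rw [measure_biUnion_null_iff (Set.to_countable _)]
  intro q hq
  rw [pathMeasure_cyl, map_pair_apply, if_neg (fun h => hq h.symm), zero_mul]

theorem real_reach_of_mem (π : M.Strategy) {T : Set S} {s : S} (hs : s ∈ T) :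
    (M.pathMeasure π s).real (reach T) = 1 := by
  rw [measureReal_def, (prob_compl_eq_zero_iff (measurableSet_reach T)).1]
  · simp
  · refine measure_mono_null ?_ (ae_iff.1 (M.ae_fst_zero π s))
    intro ρ hρ h
    exact hρ ⟨0, by rwa [h]⟩

/-- First-step decomposition of the probability of reaching `T` from outside `T`. -/
theorem real_reach_of_notMem (π : M.Strategy) {T : Set S} {s : S} (hs : s ∉ T) :
    (M.pathMeasure π s).real (reach T) = ∑ a, (π.choice 0 Fin.elim0 s a).toReal *
        M.expect (fun t => (M.pathMeasure (π.tail (s, a)) t).real (reach T)) s a := by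
  have hae : (reach T : Set (ℕ → S × Act)) =ᵐ[M.pathMeasure π s]
      ((fun x n => x (n + 1)) ⁻¹' reach T : Set (ℕ → S × Act)) := by
    filter_upwards [M.ae_fst_zero π s] with ρ hρ
    refine propext ⟨?_, ?_⟩
    · rintro ⟨i, hi⟩
      cases i with
      | zero => exact absurd (hρ ▸ hi) hs
      | succ i => exact ⟨i, hi⟩
    · rintro ⟨i, hi⟩
      exact ⟨i + 1, hi⟩
  rw [measureReal_def, measure_congr hae, pathMeasure_shift _ _ _ (measurableSet_reach T),
    ENNReal.toReal_sum]
  · refine Finset.sum_congr rfl fun a _ => ?_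
    rw [ENNReal.toReal_mul, ENNReal.toReal_sum]
    · simp [expect, measureReal_def]
    · exact fun t _ => (ENNReal.mul_lt_top (PMF.apply_lt_top _ _) (measure_lt_top _ _)).ne
  · refine fun a _ => (ENNReal.mul_lt_top (PMF.apply_lt_top _ _)
      (ENNReal.sum_lt_top.2 fun t _ => ENNReal.mul_lt_top (PMF.apply_lt_top _ _)
        (measure_lt_top _ _))).ne

end FirstStep

/-! ### Maxima and averages of bounds -/

section Expect

variable {S Act : Type*} (M : MDP S Act)

theorem le_stateBound (f : S → Act → ℝ) {s : S} {a : Act} (ha : a ∈ M.av s) :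
    f s a ≤ M.stateBound f s := Finset.le_sup' (f s) ha

theorem stateBound_le {f : S → Act → ℝ} {s : S} {c : ℝ} (h : ∀ a ∈ M.av s, f s a ≤ c) :
    M.stateBound f s ≤ c := Finset.sup'_le _ _ h

theorem exists_stateBound_eq (f : S → Act → ℝ) (s : S) :
    ∃ a ∈ M.av s, M.stateBound f s = f s a := Finset.exists_mem_eq_sup' _ _

theorem stateBound_mono {f g : S → Act → ℝ} {s : S} (h : ∀ a ∈ M.av s, f s a ≤ g s a) :
    M.stateBound f s ≤ M.stateBound g s :=
  M.stateBound_le fun a ha => (h a ha).trans (M.le_stateBound g ha)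

instance : Nonempty M.Strategy :=
  ⟨{ choice := fun _ _ s => PMF.pure (M.av_nonempty s).choose
     support_subset := fun _ _ s => by simpa using (M.av_nonempty s).choose_spec }⟩

theorem sum_toReal_pmf {α : Type*} [Fintype α] (p : PMF α) : ∑ x, (p x).toReal = 1 := by
  rw [← ENNReal.toReal_sum fun x _ => PMF.apply_ne_top p x, ← tsum_fintype (L := .unconditional _),
    p.tsum_coe, ENNReal.toReal_one]

variable [Fintype S]

theorem expect_mono_of_support {v w : S → ℝ} {s : S} {a : Act}
    (h : ∀ t ∈ (M.trans s a).support, v t ≤ w t) : M.expect v s a ≤ M.expect w s a := by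
  refine Finset.sum_le_sum fun t _ => ?_
  by_cases ht : t ∈ (M.trans s a).support
  · exact mul_le_mul_of_nonneg_left (h t ht) ENNReal.toReal_nonneg
  · simp [(PMF.apply_eq_zero_iff _ _).2 ht]

theorem expect_mono {v w : S → ℝ} (h : ∀ t, v t ≤ w t) (s : S) (a : Act) :
    M.expect v s a ≤ M.expect w s a := M.expect_mono_of_support fun t _ => h t

theorem expect_const (c : ℝ) (s : S) (a : Act) : M.expect (fun _ => c) s a = c := by
  simp [expect, ← Finset.sum_mul, sum_toReal_pmf]

theorem expect_sub (v w : S → ℝ) (s : S) (a : Act) :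
    M.expect (fun t => v t - w t) s a = M.expect v s a - M.expect w s a := by
  simp [expect, mul_sub, Finset.sum_sub_distrib]

theorem expect_eq_of_support {v : S → ℝ} {s : S} {a : Act} {c : ℝ}
    (h : ∀ t ∈ (M.trans s a).support, v t = c) : M.expect v s a = c := by
  rw [← M.expect_const c s a]
  exact le_antisymm (M.expect_mono_of_support fun t ht => (h t ht).le)
    (M.expect_mono_of_support fun t ht => (h t ht).ge)

/-- Equality case in the bound of an average by a maximum. -/
theorem eq_of_le_expect {v : S → ℝ} {s : S} {a : Act} {d : ℝ}
    (hle : ∀ t ∈ (M.trans s a).support, v t ≤ d) (h : d ≤ M.expect v s a) :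
    ∀ t ∈ (M.trans s a).support, v t = d := by
  intro t ht
  by_contra hne
  refine absurd h (not_le.2 ?_)
  rw [← M.expect_const d s a]
  refine Finset.sum_lt_sum (fun x _ => ?_) ⟨t, Finset.mem_univ _, ?_⟩
  · by_cases hx : x ∈ (M.trans s a).support
    · exact mul_le_mul_of_nonneg_left (hle x hx) ENNReal.toReal_nonneg
    · simp [(PMF.apply_eq_zero_iff _ _).2 hx]
  · exact mul_lt_mul_of_pos_left (lt_of_le_of_ne (hle t ht) hne)
      (ENNReal.toReal_pos ((PMF.mem_support_iff _ _).1 ht) (PMF.apply_ne_top _ _))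

end Expect

/-! ### The optimality equation -/

section Value

variable {S Act : Type*} [Fintype S] [Fintype Act]
  [MeasurableSpace S] [DiscreteMeasurableSpace S]
  [MeasurableSpace Act] [DiscreteMeasurableSpace Act]
  (M : MDP S Act) (T : Set S)

theorem real_reach_le_val (π : M.Strategy) (s : S) :
    (M.pathMeasure π s).real (reach T) ≤ M.val T s :=
  le_ciSup (f := fun π : M.Strategy => (M.pathMeasure π s).real (reach T))
    ⟨1, by rintro _ ⟨π, rfl⟩; exact measureReal_le_one⟩ π

variable {T} in
theorem val_of_mem {s : S} (hs : s ∈ T) : M.val T s = 1 := by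
  simp [val, M.real_reach_of_mem _ hs]

variable {T} in
/-- The optimality equation for maximal reachability probabilities. -/
theorem val_of_notMem {s : S} (hs : s ∉ T) : M.val T s = M.stateBound (M.pairVal T) s := by
  classical
  refine le_antisymm (ciSup_le fun π => ?_) (M.stateBound_le fun a ha => ?_)
  · rw [M.real_reach_of_notMem π hs]
    calc _ ≤ ∑ a, (π.choice 0 Fin.elim0 s a).toReal * M.stateBound (M.pairVal T) s := by
          refine Finset.sum_le_sum fun a _ => ?_
          by_cases ha : a ∈ (π.choice 0 Fin.elim0 s).support
          · refine mul_le_mul_of_nonneg_left ?_ ENNReal.toReal_nonneg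
            exact (M.expect_mono (fun t => M.real_reach_le_val T _ t) s a).trans
              (M.le_stateBound (M.pairVal T) (π.support_subset _ _ _ ha))
          · simp [(PMF.apply_eq_zero_iff _ _).2 ha]
      _ = M.stateBound (M.pairVal T) s := by rw [← Finset.sum_mul, sum_toReal_pmf, one_mul]
  · -- Play `a`, then a `δ`-optimal strategy from the successor that is reached.
    refine le_of_forall_pos_le_add fun δ hδ => ?_
    have hσ : ∀ t, ∃ π : M.Strategy, M.val T t - δ < (M.pathMeasure π t).real (reach T) :=
      fun t => exists_lt_of_lt_ciSup (by unfold val; linarith)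
    choose σ hσ using hσ
    let d : ∀ t, M.av t := fun t =>
      if h : t = s then ⟨a, h ▸ ha⟩ else ⟨(M.av_nonempty t).choose, (M.av_nonempty t).choose_spec⟩
    have hd : (d s).1 = a := by simp [d]
    have hval := M.real_reach_le_val T (Strategy.prepend d σ) s
    rw [M.real_reach_of_notMem _ hs, Finset.sum_eq_single a] at hval
    · simp only [pathMeasure_prepend_tail] at hval
      have hone : ((Strategy.prepend d σ).choice 0 Fin.elim0 s a).toReal = 1 := by
        change (PMF.pure (d s).1 a).toReal = 1
        simp [hd]
      rw [hone, one_mul] at hval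
      have hmono := M.expect_mono (fun t => (hσ t).le) s a
      rw [expect_sub, expect_const] at hmono
      unfold pairVal
      linarith
    · intro b _ hb
      have : ((Strategy.prepend d σ).choice 0 Fin.elim0 s b).toReal = 0 := by
        change (PMF.pure (d s).1 b).toReal = 0
        simp [hd, hb]
      rw [this, zero_mul]
    · simp

end Value

/-! ### End components -/

section EndComponents

variable {S Act : Type*} (M : MDP S Act)

theorem IsEndComponent.exists_mem_mecs [Finite S] [Finite Act] {R : Set S} {B : Set (S × Act)}
    (h : M.IsEndComponent R B) : ∃ E ∈ M.mecs, R ⊆ E.1 ∧ B ⊆ E.2 := by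
  obtain ⟨E, hE, hmax⟩ := Set.Finite.exists_le_maximal
    (s := {E : Set S × Set (S × Act) | M.IsEndComponent E.1 E.2}) (Set.toFinite _)
    (a := (R, B)) h
  refine ⟨E, ⟨hmax.prop, fun R' B' h' hR hB => ?_⟩, hE.1, hE.2⟩
  exact (hmax.eq_of_le (y := (R', B')) h' ⟨hR, hB⟩).symm

/-- A non-empty set of states that some choice of actions never leaves contains an end component. -/
theorem exists_isEndComponent_of_closed [Finite S] {R : Set S} (hR : R.Nonempty) (d : S → Act)
    (hav : ∀ s ∈ R, d s ∈ M.av s) (hcl : ∀ s ∈ R, (M.trans s (d s)).support ⊆ R) :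
    ∃ R' B, R' ⊆ R ∧ M.IsEndComponent R' B := by
  obtain ⟨Q, hQR, hQ⟩ := Set.Finite.exists_le_minimal
    (s := {Q : Set S | Q.Nonempty ∧ ∀ s ∈ Q, d s ∈ M.av s ∧ (M.trans s (d s)).support ⊆ Q})
    (Set.toFinite _) (a := R) ⟨hR, fun s hs => ⟨hav s hs, hcl s hs⟩⟩
  refine ⟨Q, {q | q.1 ∈ Q ∧ q.2 = d q.1}, hQR, hQ.prop.1, ?_, ?_, ?_, ?_⟩
  · obtain ⟨s, hs⟩ := hQ.prop.1
    exact ⟨(s, d s), hs, rfl⟩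
  · rintro ⟨s, a⟩ ⟨hs, ha⟩
    obtain rfl : a = d s := ha
    exact ⟨hs, (hQ.prop.2 s hs).1⟩
  · rintro s hs a - ⟨-, ha⟩
    obtain rfl : a = d s := ha
    exact (hQ.prop.2 s hs).2
  · intro s hs
    set Step := M.StepIn Q {q | q.1 ∈ Q ∧ q.2 = d q.1}
    have hstep : ∀ t ∈ Q, ∀ t' ∈ (M.trans t (d t)).support, Step t t' := fun t ht t' ht' =>
      ⟨ht, (hQ.prop.2 t ht).2 ht', d t, (hQ.prop.2 t ht).1, ⟨ht, rfl⟩, ht'⟩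
    -- The states reachable from `s` form a closed subset of the minimal closed set `Q`.
    have hsub : {t | t ∈ Q ∧ Relation.TransGen Step s t} ⊆ Q := fun t ht => ht.1
    have hle := hQ.le_of_le (y := {t | t ∈ Q ∧ Relation.TransGen Step s t}) ⟨?_, ?_⟩ hsub
    · exact fun t ht => (hle ht).2
    · obtain ⟨t, ht⟩ := (M.trans s (d s)).support_nonempty
      exact ⟨t, (hQ.prop.2 s hs).2 ht, .single (hstep s hs t ht)⟩
    · rintro t ⟨ht, hst⟩
      exact ⟨(hQ.prop.2 t ht).1, fun t' ht' =>
        ⟨(hQ.prop.2 t ht).2 ht', hst.tail (hstep t ht t' ht')⟩⟩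

variable {M} {sp sm : S}

theorem MecFree.symm (h : M.MecFree sp sm) : M.MecFree sm sp := by
  unfold MecFree at *
  rw [h, Set.pair_comm]

theorem MecFree.support_subset (h : M.MecFree sp sm) {a : Act} (ha : a ∈ M.av sp) :
    (M.trans sp a).support ⊆ {sp} := by
  have hE : (({sp}, {q | q.1 = sp ∧ q.2 ∈ M.av sp}) : Set S × Set (S × Act)) ∈ M.mecs := by
    rw [h]
    exact Or.inl rfl
  exact hE.1.closed sp rfl a ha ⟨rfl, ha⟩

/-- Every non-empty set of states that some choice of actions never leaves meets `{sp, sm}`. -/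
theorem MecFree.mem_of_closed [Finite S] [Finite Act] (h : M.MecFree sp sm) {R : Set S}
    (hR : R.Nonempty) (d : S → Act) (hav : ∀ s ∈ R, d s ∈ M.av s)
    (hcl : ∀ s ∈ R, (M.trans s (d s)).support ⊆ R) : sp ∈ R ∨ sm ∈ R := by
  obtain ⟨Q, B, hQR, hQ⟩ := M.exists_isEndComponent_of_closed hR d hav hcl
  obtain ⟨E, hE, hQE, -⟩ := hQ.exists_mem_mecs
  obtain ⟨t, ht⟩ := hQ.states_nonempty
  rw [h] at hE
  rcases hE with rfl | rfl
  · exact Or.inl (hQR (Set.mem_singleton_iff.1 (hQE ht) ▸ ht))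
  · exact Or.inr (hQR (Set.mem_singleton_iff.1 (hQE ht) ▸ ht))

end EndComponents

/-! ### Soundness of the bounds -/

section Bounds

variable {S Act : Type*} [Fintype S] [Fintype Act]
  [MeasurableSpace S] [DiscreteMeasurableSpace S]
  [MeasurableSpace Act] [DiscreteMeasurableSpace Act]
  {M : MDP S Act} {sp sm : S}

/-- Here the optimality equation also holds in the target `sp`, since `sp` is absorbing. -/
theorem MecFree.val_eq_stateBound (h : M.MecFree sp sm) (s : S) :
    M.val {sp} s = M.stateBound (M.pairVal {sp}) s := by
  by_cases hs : s = sp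
  · subst hs
    obtain ⟨a, ha, heq⟩ := M.exists_stateBound_eq (M.pairVal {s}) s
    rw [heq, M.val_of_mem (Set.mem_singleton s), pairVal, M.expect_eq_of_support]
    intro t ht
    exact M.val_of_mem (h.support_subset ha ht)
  · exact M.val_of_notMem hs

/-- A Bellman update preserves correctness of the bounds. The tightness in `sp` and `sm` survives
because both states are absorbing. -/
theorem InputCorrect.update (h : M.MecFree sp sm) {Up Lo : S → Act → ℝ}
    (hi : M.InputCorrect sp sm Up Lo) (K : Finset (S × Act)) :
    M.InputCorrect sp sm (M.update K Up) (M.update K Lo) := by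
  classical
  have hU0 : ∀ s, 0 ≤ M.stateBound Up s := fun s => by
    obtain ⟨a, ha⟩ := M.av_nonempty s
    exact (hi.up_mem s a ha).1.trans (M.le_stateBound Up ha)
  have hL0 : ∀ s, 0 ≤ M.stateBound Lo s := fun s => by
    obtain ⟨a, ha⟩ := M.av_nonempty s
    exact (hi.lo_mem s a ha).1.trans (M.le_stateBound Lo ha)
  have hU1 : ∀ s, M.stateBound Up s ≤ 1 := fun s => M.stateBound_le fun a ha => (hi.up_mem s a ha).2
  have hL1 : ∀ s, M.stateBound Lo s ≤ 1 := fun s => M.stateBound_le fun a ha => (hi.lo_mem s a ha).2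
  have hexp : ∀ v : S → ℝ, (∀ t, 0 ≤ v t) → (∀ t, v t ≤ 1) → ∀ s a,
      M.expect v s a ∈ Set.Icc (0 : ℝ) 1 := by
    intro v h0 h1 s a
    constructor
    · rw [← M.expect_const 0 s a]
      exact M.expect_mono h0 s a
    · rw [← M.expect_const 1 s a]
      exact M.expect_mono h1 s a
  have hupd : ∀ (p : S → Act → ℝ → Prop) (f : S → Act → ℝ) (s : S) (a : Act),
      p s a (M.expect (M.stateBound f) s a) → p s a (f s a) → p s a (M.update K f s a) := by
    intro p f s a h1 h2
    unfold MDP.update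
    split_ifs
    · exact h1
    · exact h2
  refine ⟨?_, ?_, ?_, ?_, ?_, ?_⟩
  · exact fun s a ha => hupd (fun _ _ x => x ∈ Set.Icc (0 : ℝ) 1) Up s a
      (hexp _ hU0 hU1 s a) (hi.up_mem s a ha)
  · exact fun s a ha => hupd (fun _ _ x => x ∈ Set.Icc (0 : ℝ) 1) Lo s a
      (hexp _ hL0 hL1 s a) (hi.lo_mem s a ha)
  · refine fun s a ha => hupd (fun s a x => x ≤ M.pairVal {sp} s a) Lo s a ?_ (hi.lo_le s a ha)
    refine M.expect_mono (fun t => ?_) s a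
    rw [h.val_eq_stateBound]
    exact M.stateBound_mono (hi.lo_le t)
  · refine fun s a ha => hupd (fun s a x => M.pairVal {sp} s a ≤ x) Up s a ?_ (hi.le_up s a ha)
    refine M.expect_mono (fun t => ?_) s a
    rw [h.val_eq_stateBound]
    exact M.stateBound_mono (hi.le_up t)
  · obtain ⟨a, ha, heq⟩ := M.exists_stateBound_eq Lo sp
    rw [hi.lo_target] at heq
    refine le_antisymm (M.stateBound_le fun b hb => ?_) ?_
    · exact hupd (fun _ _ x => x ≤ 1) Lo sp b (hexp _ hL0 hL1 sp b).2 (hi.lo_mem sp b hb).2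
    · refine le_trans ?_ (M.le_stateBound _ ha)
      refine hupd (fun _ _ x => 1 ≤ x) Lo sp a (ge_of_eq (M.expect_eq_of_support ?_)) heq.le
      intro t ht
      rw [Set.mem_singleton_iff.1 (h.support_subset ha ht), hi.lo_target]
  · have hzero : ∀ b ∈ M.av sm, M.update K Up sm b = 0 := by
      intro b hb
      refine hupd (fun _ _ x => x = 0) Up sm b (M.expect_eq_of_support ?_) ?_
      · intro t ht
        rw [Set.mem_singleton_iff.1 (h.symm.support_subset hb ht), hi.up_sink]
      · exact le_antisymm (hi.up_sink ▸ M.le_stateBound Up hb) (hi.up_mem sm b hb).1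
    obtain ⟨a, ha, heq⟩ := M.exists_stateBound_eq (M.update K Up) sm
    rw [heq, hzero a ha]

theorem InputCorrect.val_mem (h : M.MecFree sp sm) {Up Lo : S → Act → ℝ}
    (hi : M.InputCorrect sp sm Up Lo) (s : S) :
    M.val {sp} s ∈ Set.Icc (M.stateBound Lo s) (M.stateBound Up s) := by
  rw [h.val_eq_stateBound]
  exact ⟨M.stateBound_mono (hi.lo_le s), M.stateBound_mono (hi.le_up s)⟩

/-- The invariant of the algorithm: bounds at the head of the loop are correct, and so are results. -/
theorem config_invariant (h : M.MecFree sp sm) {s₀ : S} {ε : ℝ} {Up₁ Lo₁ : S → Act → ℝ}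
    (hi : M.InputCorrect sp sm Up₁ Lo₁) (sample : Sampler S Act) (e : ℕ) :
    (∀ Up Lo, M.config s₀ ε Up₁ Lo₁ sample e = .loop Up Lo → M.InputCorrect sp sm Up Lo) ∧
    (∀ l u, M.config s₀ ε Up₁ Lo₁ sample e = .done l u → M.EpsOptimal {sp} s₀ ε l u) := by
  induction e with
  | zero =>
    constructor
    · intro Up Lo heq
      simp only [config, Config.loop.injEq] at heq
      rwa [← heq.1, ← heq.2]
    · intro l u heq
      simp [config] at heq
  | succ e ih =>
    rw [config]
    cases hc : M.config s₀ ε Up₁ Lo₁ sample e with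
    | stuck => simp [step]
    | done l u =>
      simp only [step, Config.done.injEq, reduceCtorEq, false_imp_iff, implies_true, true_and]
      rintro _ _ ⟨rfl, rfl⟩
      exact ih.2 _ _ hc
    | loop Up Lo =>
      have hUL := ih.1 _ _ hc
      unfold step
      by_cases hε : ε ≤ M.stateBound Up s₀ - M.stateBound Lo s₀
      · simp only [hε, if_true]
        cases sample e Up Lo with
        | none => simp
        | some K =>
          simp only [Config.loop.injEq, reduceCtorEq, false_imp_iff, implies_true, and_true]
          rintro _ _ ⟨rfl, rfl⟩
          exact hUL.update h K
      · simp only [hε, if_false, reduceCtorEq, false_imp_iff, implies_true, true_and,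
          Config.done.injEq]
        rintro _ _ ⟨rfl, rfl⟩
        have hv := hUL.val_mem h s₀
        exact ⟨sub_nonneg.2 (hv.1.trans hv.2), not_le.1 hε, hv⟩

end Bounds

/-! ### Convergence of the bounds -/

section Convergence

section Limits

variable {S Act : Type*} {M : MDP S Act} {f : ℕ → S → Act → ℝ}

/-- The limit superior of the state bounds. -/
noncomputable def upperLimit (M : MDP S Act) (f : ℕ → S → Act → ℝ) (s : S) : ℝ :=
  limsup (fun e => M.stateBound (f e) s) atTop

/-- The limit inferior of the state bounds. -/
noncomputable def lowerLimit (M : MDP S Act) (f : ℕ → S → Act → ℝ) (s : S) : ℝ :=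
  liminf (fun e => M.stateBound (f e) s) atTop

variable (h01 : ∀ e s, M.stateBound (f e) s ∈ Set.Icc (0 : ℝ) 1)
include h01

theorem isBoundedUnder_le_stateBound (s : S) :
    IsBoundedUnder (· ≤ ·) atTop (fun e => M.stateBound (f e) s) :=
  isBoundedUnder_of ⟨1, fun e => (h01 e s).2⟩

theorem isBoundedUnder_ge_stateBound (s : S) :
    IsBoundedUnder (· ≥ ·) atTop (fun e => M.stateBound (f e) s) :=
  isBoundedUnder_of ⟨0, fun e => (h01 e s).1⟩

theorem upperLimit_le {s : S} {c : ℝ} (h : ∀ᶠ e in atTop, M.stateBound (f e) s ≤ c) :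
    M.upperLimit f s ≤ c :=
  limsup_le_of_le (isBoundedUnder_ge_stateBound h01 s).isCoboundedUnder_le h

theorem le_lowerLimit {s : S} {c : ℝ} (h : ∀ᶠ e in atTop, c ≤ M.stateBound (f e) s) :
    c ≤ M.lowerLimit f s :=
  le_liminf_of_le (isBoundedUnder_le_stateBound h01 s).isCoboundedUnder_ge h

theorem eventually_lt_upperLimit_add [Finite S] {δ : ℝ} (hδ : 0 < δ) :
    ∀ᶠ e in atTop, ∀ s, M.stateBound (f e) s < M.upperLimit f s + δ :=
  eventually_all.2 fun s =>
    eventually_lt_of_limsup_lt (lt_add_of_pos_right (M.upperLimit f s) hδ)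
      (isBoundedUnder_le_stateBound h01 s)

theorem eventually_lowerLimit_sub_lt [Finite S] {δ : ℝ} (hδ : 0 < δ) :
    ∀ᶠ e in atTop, ∀ s, M.lowerLimit f s - δ < M.stateBound (f e) s :=
  eventually_all.2 fun s =>
    eventually_lt_of_lt_liminf (sub_lt_self (M.lowerLimit f s) hδ)
      (isBoundedUnder_ge_stateBound h01 s)

end Limits

section Updates

variable {S Act : Type*} [Fintype S] {M : MDP S Act}

/-- If the average over the successors eventually has the property `p`, then so does the bound of a
pair that is updated infinitely often: between two updates the bound does not change. -/
theorem eventually_of_mem_pairsInf {f : ℕ → S → Act → ℝ} {K : ℕ → Finset (S × Act)}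
    (hf : ∀ e, f (e + 1) = M.update (K e) (f e)) {s : S} {a : Act} (hK : (s, a) ∈ pairsInf K)
    {p : ℝ → Prop} (hp : ∀ᶠ e in atTop, p (M.expect (M.stateBound (f e)) s a)) :
    ∀ᶠ e in atTop, p (f e s a) := by
  classical
  obtain ⟨N, hN⟩ := eventually_atTop.1 hp
  obtain ⟨e₀, he₀, hmem⟩ := frequently_atTop.1 hK N
  refine eventually_atTop.2 ⟨e₀ + 1, fun e he => ?_⟩
  induction e, he using Nat.le_induction with
  | base =>
    rw [hf, update, if_pos hmem]
    exact hN e₀ he₀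
  | succ e he ih =>
    rw [hf, update]
    split_ifs
    · exact hN e (by omega)
    · exact ih

variable {f : ℕ → S → Act → ℝ} {K : ℕ → Finset (S × Act)}
  (h01 : ∀ e s, M.stateBound (f e) s ∈ Set.Icc (0 : ℝ) 1)
  (hf : ∀ e, f (e + 1) = M.update (K e) (f e))
include h01 hf

theorem expect_lowerLimit_le {s : S} {a : Act} (ha : a ∈ M.av s) (hK : (s, a) ∈ pairsInf K) :
    M.expect (M.lowerLimit f) s a ≤ M.lowerLimit f s := by
  refine le_of_forall_pos_sub_le fun δ hδ => le_lowerLimit h01 ?_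
  have hp : ∀ᶠ e in atTop, M.expect (M.lowerLimit f) s a - δ ≤
      M.expect (M.stateBound (f e)) s a := by
    filter_upwards [eventually_lowerLimit_sub_lt h01 hδ] with e he
    have := M.expect_mono (fun t => (he t).le) s a
    rwa [expect_sub, expect_const] at this
  filter_upwards [eventually_of_mem_pairsInf hf hK hp] with e he
  exact he.trans (M.le_stateBound _ ha)

theorem eventually_le_expect_upperLimit_add {s : S} {a : Act} (hK : (s, a) ∈ pairsInf K)
    {δ : ℝ} (hδ : 0 < δ) :
    ∀ᶠ e in atTop, f e s a ≤ M.expect (M.upperLimit f) s a + δ := by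
  refine eventually_of_mem_pairsInf hf hK
    (p := fun x => x ≤ M.expect (M.upperLimit f) s a + δ) ?_
  filter_upwards [eventually_lt_upperLimit_add h01 hδ] with e he
  have := M.expect_mono (fun t => sub_le_iff_le_add.2 (he t).le) s a
  rw [expect_sub, expect_const] at this
  linarith

/-- In a state all of whose infinitely often optimal actions are updated infinitely often, the upper
limit is at most its average over the successors of one such action. Since the bounds need not be
monotone, no limit is assumed to exist. -/
theorem exists_upperLimit_le_expect {s : S} (hK : ∀ a ∈ M.maxAInf f s, (s, a) ∈ pairsInf K) :
    ∃ a ∈ M.maxAInf f s, M.upperLimit f s ≤ M.expect (M.upperLimit f) s a := by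
  by_contra! hcon
  -- Each action then stays, whenever it is optimal, below some `c < M.upperLimit f s`.
  have hc : ∀ a, ∃ c < M.upperLimit f s, ∀ᶠ e in atTop, a ∈ M.maxA (f e) s → f e s a ≤ c := by
    intro a
    by_cases ha : a ∈ M.maxAInf f s
    · have hlt := hcon a ha
      refine ⟨(M.expect (M.upperLimit f) s a + M.upperLimit f s) / 2, by linarith, ?_⟩
      filter_upwards [eventually_le_expect_upperLimit_add h01 hf (hK a ha)
        (half_pos (sub_pos.2 hlt))] with e he _
      linarith
    · refine ⟨M.upperLimit f s - 1, by linarith, ?_⟩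
      filter_upwards [not_frequently.1 ha] with e he he'
      exact absurd he' he
  choose c hlt hc using hc
  refine absurd (upperLimit_le h01 (s := s) (c := (M.av s).sup' (M.av_nonempty s) c) ?_)
    (not_le.2 ((Finset.sup'_lt_iff _).2 fun a _ => hlt a))
  have hall : ∀ᶠ e in atTop, ∀ a ∈ M.av s, a ∈ M.maxA (f e) s → f e s a ≤ c a :=
    (eventually_all_finset _).2 fun a _ => hc a
  filter_upwards [hall] with e he
  obtain ⟨a, ha, heq⟩ := M.exists_stateBound_eq (f e) s
  rw [heq]
  exact (he a ha ⟨ha, fun b hb => heq ▸ M.le_stateBound (f e) hb⟩).trans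
    (Finset.le_sup' c ha)

end Updates

/-- Along a fair infinite execution the gap between the upper limit of the upper bounds and the
lower limit of the lower bounds closes in every state that occurs infinitely often: the states of
maximal gap could otherwise be confined by suitable actions, without containing `sp` or `sm`. -/
theorem FairSeq.upperLimit_le_lowerLimit {S Act : Type*} [Fintype S] [Finite Act] {M : MDP S Act}
    {sp sm s₀ : S} (hmec : M.MecFree sp sm)
    {Up Lo : ℕ → S → Act → ℝ} {K : ℕ → Finset (S × Act)} (hfair : M.FairSeq s₀ Up K)
    (hU : ∀ e, Up (e + 1) = M.update (K e) (Up e)) (hL : ∀ e, Lo (e + 1) = M.update (K e) (Lo e))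
    (hU01 : ∀ e s, M.stateBound (Up e) s ∈ Set.Icc (0 : ℝ) 1)
    (hL01 : ∀ e s, M.stateBound (Lo e) s ∈ Set.Icc (0 : ℝ) 1)
    (hsp : ∀ e, M.stateBound (Lo e) sp = 1) (hsm : ∀ e, M.stateBound (Up e) sm = 0)
    {s : S} (hs : s ∈ statesInf K) : M.upperLimit Up s ≤ M.lowerLimit Lo s := by
  let gap : S → ℝ := fun t => M.upperLimit Up t - M.lowerLimit Lo t
  have hstep : ∀ t ∈ statesInf K, ∃ a ∈ M.maxAInf Up t, gap t ≤ M.expect gap t a := by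
    intro t ht
    obtain ⟨a, ha, hle⟩ := exists_upperLimit_le_expect hU01 hU (hfair.actions t ht)
    obtain ⟨e, he⟩ := ha.exists
    refine ⟨a, ha, ?_⟩
    have := expect_lowerLimit_le hL01 hL he.1 (hfair.actions t ht a ha)
    simp only [gap, expect_sub]
    linarith
  obtain ⟨m, hm, hmax⟩ := (Set.toFinite (statesInf K)).exists_maximalFor gap _ ⟨s, hs⟩
  replace hmax : ∀ t ∈ statesInf K, gap t ≤ gap m := fun t ht =>
    (le_total (gap t) (gap m)).elim id (hmax ht)
  suffices h : gap m ≤ 0 from sub_nonpos.1 ((hmax s hs).trans h)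
  have hne : Nonempty Act := ⟨(hstep s hs).choose⟩
  choose! d hd hgap using hstep
  have hmem : sp ∈ {t ∈ statesInf K | gap t = gap m} ∨ sm ∈ {t ∈ statesInf K | gap t = gap m} := by
    refine hmec.mem_of_closed ⟨m, hm, rfl⟩ d (fun t ht => ?_) fun t ht t' ht' => ?_
    · obtain ⟨e, he⟩ := (hd t ht.1).exists
      exact he.1
    · have hsucc := hfair.successors t ht.1 _ (hd t ht.1)
      exact ⟨hsucc ht', M.eq_of_le_expect (fun x hx => hmax x (hsucc hx))
        (ht.2 ▸ hgap t ht.1) t' ht'⟩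
  rcases hmem with ⟨-, h⟩ | ⟨-, h⟩
  · rw [← h]
    exact sub_nonpos.2 ((upperLimit_le hU01 (.of_forall fun e => (hU01 e sp).2)).trans
      (le_lowerLimit hL01 (.of_forall fun e => (hsp e).ge)))
  · rw [← h]
    exact sub_nonpos.2 ((upperLimit_le hU01 (.of_forall fun e => (hsm e).le)).trans
      (le_lowerLimit hL01 (.of_forall fun e => (hL01 e sm).1)))

end Convergence

/-! ### Termination -/

section Termination

variable {S Act : Type*} [Fintype S] [Fintype Act]
  [MeasurableSpace S] [DiscreteMeasurableSpace S]
  [MeasurableSpace Act] [DiscreteMeasurableSpace Act]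
  {M : MDP S Act} {sp sm : S}

theorem InputCorrect.stateBound_mem {Up Lo : S → Act → ℝ} (hi : M.InputCorrect sp sm Up Lo)
    (s : S) : M.stateBound Up s ∈ Set.Icc (0 : ℝ) 1 ∧ M.stateBound Lo s ∈ Set.Icc (0 : ℝ) 1 := by
  obtain ⟨a, ha, heq⟩ := M.exists_stateBound_eq Up s
  obtain ⟨b, hb, heq'⟩ := M.exists_stateBound_eq Lo s
  rw [heq, heq']
  exact ⟨hi.up_mem s a ha, hi.lo_mem s b hb⟩

/-- A fair execution terminates. -/
theorem Fair.exists_returns (hmec : M.MecFree sp sm) {s₀ : S} {ε : ℝ} (hε : 0 < ε)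
    {Up₁ Lo₁ : S → Act → ℝ} (hi : M.InputCorrect sp sm Up₁ Lo₁) {sample : Sampler S Act}
    (hfair : M.Fair s₀ ε Up₁ Lo₁ sample) : ∃ l u, M.Returns s₀ ε Up₁ Lo₁ sample l u := by
  by_contra! hcon
  have hdone : ∀ e l u, M.config s₀ ε Up₁ Lo₁ sample e ≠ .done l u :=
    fun e l u heq => hcon l u ⟨e, heq⟩
  -- As long as the execution is inside the loop, the loop condition holds and the call returns.
  have hiter : ∀ e Up Lo, M.config s₀ ε Up₁ Lo₁ sample e = .loop Up Lo →
      ε ≤ M.stateBound Up s₀ - M.stateBound Lo s₀ ∧ ∃ K, sample e Up Lo = some K ∧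
        M.config s₀ ε Up₁ Lo₁ sample (e + 1) = .loop (M.update K Up) (M.update K Lo) := by
    intro e Up Lo heq
    have hcond : ε ≤ M.stateBound Up s₀ - M.stateBound Lo s₀ := by
      by_contra hcond
      refine hdone (e + 1) (M.stateBound Lo s₀) (M.stateBound Up s₀) ?_
      simp [config, heq, step, hcond]
    obtain ⟨K, hK, -⟩ := hfair.call e Up Lo heq hcond
    exact ⟨hcond, K, hK, by simp [config, heq, step, hcond, hK]⟩
  have hloop : ∀ e, ∃ Up Lo, M.config s₀ ε Up₁ Lo₁ sample e = .loop Up Lo := by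
    intro e
    induction e with
    | zero => exact ⟨Up₁, Lo₁, rfl⟩
    | succ e ih =>
      obtain ⟨Up, Lo, heq⟩ := ih
      obtain ⟨-, K, -, hnext⟩ := hiter e Up Lo heq
      exact ⟨_, _, hnext⟩
  choose Up Lo heq using hloop
  choose hcond K hK hnext using fun e => hiter e (Up e) (Lo e) (heq e)
  have hupd : ∀ e, Up (e + 1) = M.update (K e) (Up e) ∧ Lo (e + 1) = M.update (K e) (Lo e) := by
    intro e
    have := hnext e
    rwa [heq, Config.loop.injEq] at this
  have hinv : ∀ e, M.InputCorrect sp sm (Up e) (Lo e) := fun e =>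
    (config_invariant hmec hi sample e).1 _ _ (heq e)
  have hU01 := fun e s => ((hinv e).stateBound_mem s).1
  have hL01 := fun e s => ((hinv e).stateBound_mem s).2
  have hseq := hfair.limit Up Lo K fun e => ⟨heq e, hK e⟩
  have hle := hseq.upperLimit_le_lowerLimit hmec (fun e => (hupd e).1) (fun e => (hupd e).2)
    hU01 hL01 (fun e => (hinv e).lo_target) (fun e => (hinv e).up_sink) hseq.initial
  obtain ⟨e, heU, heL⟩ := ((eventually_lt_upperLimit_add hU01 (half_pos hε)).and
    (eventually_lowerLimit_sub_lt hL01 (half_pos hε))).exists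
  linarith [hcond e, heU s₀, heL s₀]

end Termination

end MDP

theorem mainTheorem1 {S Act : Type*} [Fintype S] [Fintype Act]
    [MeasurableSpace S] [DiscreteMeasurableSpace S]
    [MeasurableSpace Act] [DiscreteMeasurableSpace Act]
    (M : MDP S Act) (sp sm s₀ : S) (hne : sp ≠ sm) (ε : ℝ) (hε : 0 < ε)
    (hmec : M.MecFree sp sm)
    (Up₁ Lo₁ : S → Act → ℝ) (hinput : M.InputCorrect sp sm Up₁ Lo₁)
    {Ω : Type*} [MeasurableSpace Ω] (P : Measure Ω) [IsProbabilityMeasure P]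
    (sample : Ω → MDP.Sampler S Act) :
    -- every result is correct
    (∀ ω l u, M.Returns s₀ ε Up₁ Lo₁ (sample ω) l u → M.EpsOptimal {sp} s₀ ε l u) ∧
    -- sure convergence under sure fairness
    ((∀ ω, M.Fair s₀ ε Up₁ Lo₁ (sample ω)) →
      ∀ ω, ∃ l u, M.Returns s₀ ε Up₁ Lo₁ (sample ω) l u ∧ M.EpsOptimal {sp} s₀ ε l u) ∧
    -- almost sure convergence under almost sure fairness
    ((∀ᵐ ω ∂P, M.Fair s₀ ε Up₁ Lo₁ (sample ω)) →
      ∀ᵐ ω ∂P, ∃ l u, M.Returns s₀ ε Up₁ Lo₁ (sample ω) l u ∧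
        M.EpsOptimal {sp} s₀ ε l u) := by
  have hsound : ∀ ω l u, M.Returns s₀ ε Up₁ Lo₁ (sample ω) l u → M.EpsOptimal {sp} s₀ ε l u := by
    rintro ω l u ⟨e, he⟩
    exact (MDP.config_invariant hmec hinput (sample ω) e).2 l u he
  have hterm : ∀ ω, M.Fair s₀ ε Up₁ Lo₁ (sample ω) →
      ∃ l u, M.Returns s₀ ε Up₁ Lo₁ (sample ω) l u ∧ M.EpsOptimal {sp} s₀ ε l u := by
    intro ω hω
    obtain ⟨l, u, hret⟩ := hω.exists_returns hmec hε hinput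
    exact ⟨l, u, hret, hsound ω l u hret⟩
  exact ⟨hsound, fun h ω => hterm ω (h ω), fun h => h.mono hterm⟩
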